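/- For $n\ge 2$ let $S_n$ be the $n\times n$ complex matrix with ones on the subdiagonal and zeros elsewhere, i.e. $(S_n)_{ij}=1$ if $i=j+1$ and $(S_n)_{ij}=0$ otherwise. For an $n\times n$ complex matrix $T$ and $1\le k\le n$, the rank-$k$ numerical range of $T$ is $$\Lambda_k(T)=\{\lambda\in\mathbb{C} : PTP=\lambda P \text{ for some orthogonal projection } P \text{ of rank } k \text{ on } \mathbb{C}^n\}.$$ **Theorem 2.1.** For all integers $n\ge 2$ and $1\le k\le n$: 1. if $1\le k\le\left\lfloor\frac{n+1}{2}\right\rfloor$, then $$\Lambda_k(S_n)=\left\{z\in\mathbb{C} : |z|\le\cos\frac{k\pi}{n+1}\right\};$$ 2. if $\left\lfloor\frac{n+1}{2}\right\rfloor<k\le n$, then $\Lambda_k(S_n)=\emptyset$. -/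

import Mathlib

/-- The `n × n` shift matrix: ones on the subdiagonal (entries `(j + 1, j)`), zeros elsewhere. -/
def shiftMatrix (n : ℕ) : Matrix (Fin n) (Fin n) ℂ :=
  Matrix.of fun i j => if (i : ℕ) = (j : ℕ) + 1 then 1 else 0

/-- The rank-`k` numerical range of an `n × n` complex matrix `T`: the set of all `c : ℂ` with
`P T P = c P` for some rank-`k` orthogonal projection `P` of `ℂⁿ`, that is, some matrix `P` with
`P * P = P`, `Pᴴ = P` and rank `k`. -/
def rankNumericalRange {n : ℕ} (k : ℕ) (T : Matrix (Fin n) (Fin n) ℂ) : Set ℂ :=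
  {c : ℂ | ∃ P : Matrix (Fin n) (Fin n) ℂ,
    P * P = P ∧ P.conjTranspose = P ∧ P.rank = k ∧ P * T * P = c • P}

open Matrix

/-! Conjugation by diagonal unitaries turns `S` into `u • S`, so only real `r = ‖z‖` matters. Upper
bound: `S + Sᵀ` has sine eigenvectors with eigenvalues `2 cos θ_j`, and a Courant–Fischer dimension
count bounds `r`; a negative cosine forces emptiness. Lower bound for `r > 0`: with `M = S - r`,
geometrically weighted sine vectors satisfy `u_j² M w_j = -Mᵀ w_j`. They are real, independent and
pairwise isotropic for `M`, so `S` compresses to `r` on their span. For `r = 0`, alternate basis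
vectors suffice. -/

theorem shiftMatrix_mulVec_zero {n : ℕ} (f : ℕ → ℂ) (h : 0 < n) :
    (shiftMatrix n *ᵥ fun m => f m) ⟨0, h⟩ = 0 := by
  simp [shiftMatrix, mulVec, dotProduct]

theorem shiftMatrix_mulVec_succ {n : ℕ} (f : ℕ → ℂ) (a : ℕ) (h : a + 1 < n) :
    (shiftMatrix n *ᵥ fun m => f m) ⟨a + 1, h⟩ = f a := by
  simp only [shiftMatrix, mulVec, dotProduct, of_apply, ite_mul, one_mul, zero_mul]
  rw [Finset.sum_eq_single ⟨a, by omega⟩]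
  · simp
  · intro b _ hb
    rw [if_neg]
    intro h'
    exact hb (Fin.ext (by simp at h' ⊢; omega))
  · simp

theorem shiftMatrix_transpose_mulVec {n : ℕ} (f : ℕ → ℂ) (hf : f n = 0) (m : Fin n) :
    ((shiftMatrix n)ᵀ *ᵥ fun m => f m) m = f (m + 1) := by
  simp only [shiftMatrix, mulVec, dotProduct, of_apply, transpose_apply, ite_mul, one_mul,
    zero_mul]
  by_cases h : (m : ℕ) + 1 < n
  · rw [Finset.sum_eq_single ⟨m + 1, h⟩]
    · simp
    · intro b _ hb
      rw [if_neg]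
      intro h'
      exact hb (Fin.ext h')
    · simp
  · have hm : (m : ℕ) + 1 = n := by omega
    rw [hm, hf]
    refine Finset.sum_eq_zero fun b _ => if_neg ?_
    have := b.2
    omega

theorem shiftMatrix_conjTranspose (n : ℕ) : (shiftMatrix n)ᴴ = (shiftMatrix n)ᵀ := by
  ext i j
  simp only [shiftMatrix, conjTranspose_apply, transpose_apply, of_apply]
  split_ifs <;> simp

/-- The vector with entries `u ^ m * sin ((m + 1) * θ)`. -/
noncomputable def weightedSine (n : ℕ) (u θ : ℝ) : Fin n → ℂ :=
  fun m => ((u ^ (m : ℕ) * Real.sin (((m : ℕ) + 1) * θ) : ℝ) : ℂ)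

theorem star_weightedSine (n : ℕ) (u θ : ℝ) : star (weightedSine n u θ) = weightedSine n u θ := by
  ext m
  exact Complex.conj_ofReal _

/-- Entrywise this is `sin(mθ) + sin((m+2)θ) = 2 cos θ sin((m+1)θ)`. The boundary terms vanish: `sin
0` on the left, `hθ` on the right. -/
theorem sq_smul_shiftMatrix_sub_mulVec_weightedSine {n : ℕ} {r u θ : ℝ}
    (hθ : Real.sin ((n + 1) * θ) = 0) (h : r * (1 + u ^ 2) = 2 * u * Real.cos θ) :
    (u ^ 2 : ℂ) • ((shiftMatrix n - (r : ℂ) • 1) *ᵥ weightedSine n u θ) =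
      -((shiftMatrix n - (r : ℂ) • 1)ᵀ *ᵥ weightedSine n u θ) := by
  set f : ℕ → ℂ := fun m => ((u ^ m * Real.sin ((m + 1) * θ) : ℝ) : ℂ) with hf
  have hw : weightedSine n u θ = fun m : Fin n => f m := rfl
  have hfn : f n = 0 := by simp only [hf, hθ, mul_zero, Complex.ofReal_zero]
  rw [transpose_sub, transpose_smul, transpose_one, sub_mulVec, sub_mulVec, smul_mulVec,
    one_mulVec, hw]
  ext ⟨m, hm⟩
  simp only [Pi.smul_apply, Pi.sub_apply, Pi.neg_apply, smul_eq_mul]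
  rw [shiftMatrix_transpose_mulVec f hfn]
  rcases m with _ | a
  · rw [shiftMatrix_mulVec_zero]
    simp only [hf]
    norm_cast
    have e : Real.sin (((0 + 1 + 1 : ℕ) : ℝ) * θ) = 2 * Real.sin θ * Real.cos θ := by
      rw [← Real.sin_two_mul]; norm_num
    rw [e]
    simp only [Nat.cast_one, zero_add, one_mul, pow_zero, pow_one]
    linear_combination (-Real.sin θ) * h
  · rw [shiftMatrix_mulVec_succ]
    simp only [hf]
    norm_cast
    have e1 : Real.sin ((a + 1) * θ) = Real.sin ((a + 2) * θ) * Real.cos θ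
        - Real.cos ((a + 2) * θ) * Real.sin θ := by
      rw [← Real.sin_sub]; congr 1; ring
    have e3 : Real.sin ((a + 3) * θ) = Real.sin ((a + 2) * θ) * Real.cos θ
        + Real.cos ((a + 2) * θ) * Real.sin θ := by
      rw [← Real.sin_add]; congr 1; ring
    have c1 : (((a + 1 : ℕ) : ℝ)) = a + 1 := by push_cast; ring
    have c2 : (((a + 1 + 1 : ℕ) : ℝ)) = a + 2 := by push_cast; ring
    have c3 : (((a + 1 + 1 + 1 : ℕ) : ℝ)) = a + 3 := by push_cast; ring
    rw [c1, c2, c3, e1, e3]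
    linear_combination (-u ^ (a + 1) * Real.sin ((a + 2) * θ)) * h

/-! ### Compressions and circular symmetry -/

-- `V (VᴴV)⁻¹ Vᴴ` is the orthogonal projection onto the column space, so independent columns need
-- not be orthonormalized.
open scoped ComplexOrder in
theorem mem_rankNumericalRange_of_conjTranspose_mul {n k : ℕ} {T : Matrix (Fin n) (Fin n) ℂ}
    {c : ℂ} (V : Matrix (Fin n) (Fin k) ℂ) (hV : Function.Injective V.mulVec)
    (h : Vᴴ * T * V = c • (Vᴴ * V)) : c ∈ rankNumericalRange k T := by
  have hpd : (Vᴴ * V).PosDef := PosDef.conjTranspose_mul_self V hV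
  have hdet : IsUnit (Vᴴ * V).det := (isUnit_iff_isUnit_det _).1 hpd.isUnit
  have hG : (Vᴴ * V)⁻¹ * (Vᴴ * V) = 1 := nonsing_inv_mul _ hdet
  have hPV : V * (Vᴴ * V)⁻¹ * Vᴴ * V = V := by
    rw [Matrix.mul_assoc, Matrix.mul_assoc, hG, Matrix.mul_one]
  refine ⟨V * (Vᴴ * V)⁻¹ * Vᴴ, ?_, ?_, ?_, ?_⟩
  · rw [← Matrix.mul_assoc, ← Matrix.mul_assoc, hPV]
  · simp [conjTranspose_mul, conjTranspose_nonsing_inv, Matrix.mul_assoc]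
  · have hVr : V.rank = k := by
      rw [← rank_conjTranspose_mul_self, rank_of_isUnit _ hpd.isUnit, Fintype.card_fin]
    apply le_antisymm
    · rw [Matrix.mul_assoc]
      exact (rank_mul_le_left _ _).trans hVr.le
    · conv_lhs => rw [← hVr, ← hPV]
      exact rank_mul_le_left _ _
  · calc V * (Vᴴ * V)⁻¹ * Vᴴ * T * (V * (Vᴴ * V)⁻¹ * Vᴴ)
        = V * (Vᴴ * V)⁻¹ * (Vᴴ * T * V) * (Vᴴ * V)⁻¹ * Vᴴ := by
          simp only [Matrix.mul_assoc]
      _ = c • (V * ((Vᴴ * V)⁻¹ * (Vᴴ * V)) * (Vᴴ * V)⁻¹ * Vᴴ) := by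
          rw [h]; simp only [Matrix.mul_assoc, Matrix.mul_smul, Matrix.smul_mul]
      _ = _ := by rw [hG, Matrix.mul_one]

theorem mul_mem_rankNumericalRange_shiftMatrix {n k : ℕ} {z u : ℂ} (hu : ‖u‖ = 1)
    (hz : z ∈ rankNumericalRange k (shiftMatrix n)) :
    u * z ∈ rankNumericalRange k (shiftMatrix n) := by
  obtain ⟨P, hPP, hPH, hPr, hP⟩ := hz
  have huu : u * star u = 1 := by
    have := Complex.mul_conj' u
    simpa [hu] using this
  set D : Matrix (Fin n) (Fin n) ℂ := diagonal fun m => u ^ (m : ℕ) with hD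
  have hDD : D * Dᴴ = 1 := by
    rw [hD, diagonal_conjTranspose, diagonal_mul_diagonal, ← diagonal_one]
    congr 1
    ext m
    simp only [Pi.star_apply, star_pow]
    rw [← mul_pow, huu, one_pow]
  have hDD' : Dᴴ * D = 1 := mul_eq_one_comm.1 hDD
  have hDS : D * shiftMatrix n * Dᴴ = u • shiftMatrix n := by
    ext i j
    rw [hD, diagonal_conjTranspose, mul_diagonal, diagonal_mul]
    simp only [shiftMatrix, of_apply, Pi.star_apply, star_pow, Matrix.smul_apply, smul_eq_mul]
    split_ifs with h
    · rw [h, pow_succ, mul_one, mul_one, mul_right_comm, ← mul_pow, huu, one_pow, one_mul]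
    · simp
  have hdet : IsUnit D.det := (isUnit_iff_isUnit_det _).1 (IsUnit.of_mul_eq_one _ hDD)
  have hdet' : IsUnit Dᴴ.det := (isUnit_iff_isUnit_det _).1 (IsUnit.of_mul_eq_one _ hDD')
  refine ⟨Dᴴ * P * D, ?_, ?_, ?_, ?_⟩
  · calc Dᴴ * P * D * (Dᴴ * P * D) = Dᴴ * P * (D * Dᴴ) * P * D := by simp only [Matrix.mul_assoc]
      _ = Dᴴ * (P * P) * D := by rw [hDD, Matrix.mul_one, Matrix.mul_assoc Dᴴ]
      _ = _ := by rw [hPP]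
  · simp [conjTranspose_mul, hPH, Matrix.mul_assoc]
  · rw [rank_mul_eq_left_of_isUnit_det _ _ hdet, rank_mul_eq_right_of_isUnit_det _ _ hdet', hPr]
  · calc Dᴴ * P * D * shiftMatrix n * (Dᴴ * P * D)
        = Dᴴ * (P * (D * shiftMatrix n * Dᴴ) * P) * D := by simp only [Matrix.mul_assoc]
      _ = u • (Dᴴ * (P * shiftMatrix n * P) * D) := by
        rw [hDS]; simp only [Matrix.mul_smul, Matrix.smul_mul]
      _ = _ := by rw [hP]; simp only [Matrix.mul_smul, Matrix.smul_mul, smul_smul]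

theorem mem_rankNumericalRange_shiftMatrix_iff_norm {n k : ℕ} {z : ℂ} :
    z ∈ rankNumericalRange k (shiftMatrix n) ↔
      (‖z‖ : ℂ) ∈ rankNumericalRange k (shiftMatrix n) := by
  rcases eq_or_ne z 0 with rfl | hz
  · simp
  have hz' : (‖z‖ : ℂ) ≠ 0 := by simpa using hz
  constructor <;> intro h
  · have := mul_mem_rankNumericalRange_shiftMatrix (u := ‖z‖ / z) (by simp [hz]) h
    rwa [div_mul_cancel₀ _ hz] at this
  · have := mul_mem_rankNumericalRange_shiftMatrix (u := z / ‖z‖) (by simp [hz]) h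
    rwa [div_mul_cancel₀ _ hz'] at this

/-! ### Sine angles -/

/-- The angle `(j + 1) π / (n + 1)`. -/
noncomputable def sineAngle (n j : ℕ) : ℝ := ((j + 1 : ℕ) : ℝ) * Real.pi / ((n : ℝ) + 1)

theorem sin_succ_mul_sineAngle (n j : ℕ) : Real.sin ((n + 1) * sineAngle n j) = 0 := by
  have : ((n : ℝ) + 1) * sineAngle n j = ((j + 1 : ℕ) : ℝ) * Real.pi := by
    rw [sineAngle]; field_simp
  rw [this, Real.sin_nat_mul_pi]

theorem sineAngle_strictMono (n : ℕ) : StrictMono (sineAngle n) := by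
  intro i j h
  have : (i : ℝ) < j := by exact_mod_cast h
  unfold sineAngle
  push_cast
  gcongr

theorem sineAngle_pos (n j : ℕ) : 0 < sineAngle n j := by
  unfold sineAngle; positivity

theorem sineAngle_lt_pi {n j : ℕ} (h : j < n) : sineAngle n j < Real.pi := by
  have : (j : ℝ) < n := by exact_mod_cast h
  rw [sineAngle, div_lt_iff₀ (by positivity), mul_comm]
  push_cast
  gcongr

theorem cos_sineAngle_lt {n i j : ℕ} (h : i < j) (hj : j < n) :
    Real.cos (sineAngle n j) < Real.cos (sineAngle n i) :=
  Real.cos_lt_cos_of_nonneg_of_le_pi (sineAngle_pos n i).le (sineAngle_lt_pi hj).le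
    (sineAngle_strictMono n h)

theorem weightedSine_ne_zero {n j : ℕ} (u : ℝ) (h : j < n) :
    weightedSine n u (sineAngle n j) ≠ 0 := by
  intro h0
  have := congrFun h0 ⟨0, by omega⟩
  simp only [weightedSine, Pi.zero_apply, Complex.ofReal_eq_zero, pow_zero, one_mul,
    Nat.cast_zero, zero_add] at this
  exact (Real.sin_pos_of_pos_of_lt_pi (sineAngle_pos n j) (sineAngle_lt_pi h)).ne' this

/-! ### Lower bound: isotropic subspaces -/

/-- The two roots in `u` have product 1; the witness is the larger. -/
theorem exists_one_le_mul_one_add_sq_eq {r c : ℝ} (hr : 0 < r) (hrc : r ≤ c) :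
    ∃ u : ℝ, 1 ≤ u ∧ r * (1 + u ^ 2) = 2 * u * c := by
  have hs : 0 ≤ c ^ 2 - r ^ 2 := by nlinarith
  refine ⟨(c + √(c ^ 2 - r ^ 2)) / r, ?_, ?_⟩
  · rw [le_div_iff₀ hr]
    have := Real.sqrt_nonneg (c ^ 2 - r ^ 2)
    linarith
  · have := Real.sq_sqrt hs
    field_simp
    linear_combination this

theorem det_shiftMatrix_sub_smul_one (n : ℕ) (r : ℂ) :
    (shiftMatrix n - r • 1).det = (-r) ^ n := by
  rw [det_of_isLowerTriangular]
  · simp [shiftMatrix]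
  · intro i j hij
    have hij : i < j := hij
    have h1 : ¬ ((i : ℕ) = j + 1) := by have : (i : ℕ) < j := hij; omega
    simp [shiftMatrix, h1, hij.ne]

theorem mem_rankNumericalRange_shiftMatrix_of_pos {n k : ℕ} (hkn : k < n) {r : ℝ} (hr : 0 < r)
    (hrk : r ≤ Real.cos (sineAngle n k)) :
    (r : ℂ) ∈ rankNumericalRange (k + 1) (shiftMatrix n) := by
  have hc : ∀ j : Fin (k + 1), r ≤ Real.cos (sineAngle n j) := by
    intro j
    rcases (Nat.lt_succ_iff.1 j.2).eq_or_lt with h | h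
    · rwa [h]
    · exact hrk.trans (cos_sineAngle_lt h hkn).le
  choose u hu1 hu using fun j => exists_one_le_mul_one_add_sq_eq hr (hc j)
  -- `r` and `u j` determine the cosine, and the cosines are distinct.
  have huinj : Function.Injective u := by
    have key : ∀ i j : Fin (k + 1), i < j → u i ≠ u j := by
      intro i j hij he
      have h1 := hu i
      have h2 := hu j
      rw [he] at h1
      have h3 : Real.cos (sineAngle n j) < Real.cos (sineAngle n i) :=
        cos_sineAngle_lt hij (by omega)
      have := hu1 j
      nlinarith
    intro i j hij
    by_contra hne
    rcases lt_or_gt_of_ne hne with h | h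
    · exact key i j h hij
    · exact key j i h hij.symm
  set M : Matrix (Fin n) (Fin n) ℂ := shiftMatrix n - (r : ℂ) • 1 with hM
  set w : Fin (k + 1) → Fin n → ℂ := fun j => weightedSine n (u j) (sineAngle n j) with hw
  have heig : ∀ j, ((u j : ℂ) ^ 2) • (M *ᵥ w j) = -(Mᵀ *ᵥ w j) := fun j =>
    sq_smul_shiftMatrix_sub_mulVec_weightedSine (sin_succ_mul_sineAngle n j) (hu j)
  have hswap : ∀ i j, (u j : ℂ) ^ 2 * (w i ⬝ᵥ M *ᵥ w j) = -(w j ⬝ᵥ M *ᵥ w i) := by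
    intro i j
    rw [← smul_eq_mul, ← dotProduct_smul, heig, dotProduct_neg, mulVec_transpose,
      dotProduct_comm, dotProduct_mulVec]
  have hiso : ∀ i j, w i ⬝ᵥ M *ᵥ w j = 0 := by
    intro i j
    have h1 := hswap i j
    have h2 := hswap j i
    by_cases hij : i = j
    · subst hij
      have h3 : ((u i : ℂ) ^ 2 + 1) * (w i ⬝ᵥ M *ᵥ w i) = 0 := by linear_combination h1
      refine (mul_eq_zero.1 h3).resolve_left ?_
      have : u i ^ 2 + 1 ≠ 0 := by positivity
      exact_mod_cast this
    -- Swapping twice multiplies the form by `u i² u j²`, which exceeds 1 because both `u`'s are at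
    -- least 1 and they differ.
    · have h3 : ((u i : ℂ) ^ 2 * (u j : ℂ) ^ 2 - 1) * (w i ⬝ᵥ M *ᵥ w j) = 0 := by
        linear_combination (u i : ℂ) ^ 2 * h1 - h2
      refine (mul_eq_zero.1 h3).resolve_left ?_
      have : u i ^ 2 * u j ^ 2 - 1 ≠ 0 := by
        intro h0
        have hi := hu1 i
        have hj := hu1 j
        have hne : u i ≠ u j := fun h => hij (huinj h)
        have hi2 : 1 ≤ u i ^ 2 := one_le_pow₀ hi
        have hj2 : 1 ≤ u j ^ 2 := one_le_pow₀ hj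
        have ei : u i ^ 2 = 1 := by nlinarith
        have ej : u j ^ 2 = 1 := by nlinarith
        apply hne
        nlinarith
      exact_mod_cast this
  have hMdet : IsUnit M.det := by
    rw [hM, det_shiftMatrix_sub_smul_one]
    exact (IsUnit.mk0 _ (by simpa using hr.ne')).pow n
  have hli : LinearIndependent ℂ w := by
    -- The `w j` are eigenvectors of `M⁻¹ Mᵀ` for the distinct values `-u j²`; `M` is invertible
    -- since `r ≠ 0`.
    refine Module.End.eigenvectors_linearIndependent' (toLin' (M⁻¹ * Mᵀ))
      (fun j => -(u j : ℂ) ^ 2) ?_ w ?_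
    · intro i j hij
      have h : u i ^ 2 = u j ^ 2 := by
        have := neg_injective hij
        exact_mod_cast this
      exact huinj ((sq_eq_sq₀ (by linarith [hu1 i]) (by linarith [hu1 j])).1 h)
    · intro j
      refine ⟨Module.End.mem_eigenspace_iff.2 ?_, weightedSine_ne_zero _ (by omega)⟩
      rw [toLin'_apply, ← mulVec_mulVec, ← neg_neg (Mᵀ *ᵥ w j), ← heig, mulVec_neg, mulVec_smul,
        mulVec_mulVec, nonsing_inv_mul _ hMdet, one_mulVec, neg_smul]
  refine mem_rankNumericalRange_of_conjTranspose_mul (of w)ᵀ ?_ ?_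
  · rw [mulVec_injective_iff]
    exact hli
  · have h0 : (of w)ᵀᴴ * M * (of w)ᵀ = 0 := by
      ext i j
      have : ((of w)ᵀᴴ * M * (of w)ᵀ) i j = star (w i) ⬝ᵥ M *ᵥ w j := by
        rw [Matrix.mul_assoc]; rfl
      rw [this, hw, star_weightedSine]
      exact hiso i j
    rw [hM, Matrix.mul_sub, Matrix.sub_mul, sub_eq_zero] at h0
    simpa using h0

/-- The shift sends even-indexed basis vectors to odd-indexed ones, so its compression to their span
is zero. -/
theorem zero_mem_rankNumericalRange_shiftMatrix {n k : ℕ} (hk : k ≤ (n + 1) / 2) :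
    (0 : ℂ) ∈ rankNumericalRange k (shiftMatrix n) := by
  have hlt : ∀ j : Fin k, 2 * (j : ℕ) < n := fun j => by omega
  set e : Fin k → Fin n := fun j => ⟨2 * j, hlt j⟩ with he
  have hinj : Function.Injective e := by
    intro i j h
    simp only [he, Fin.mk.injEq] at h
    exact Fin.ext (by omega)
  set V : Matrix (Fin n) (Fin k) ℂ := (1 : Matrix (Fin n) (Fin n) ℂ).submatrix id e with hV
  have hVV : ∀ T : Matrix (Fin n) (Fin n) ℂ, Vᴴ * T * V = T.submatrix e e := by
    intro T
    rw [hV, conjTranspose_submatrix, conjTranspose_one]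
    ext i j
    simp [Matrix.mul_apply, Matrix.one_apply]
  refine mem_rankNumericalRange_of_conjTranspose_mul V ?_ ?_
  · have h1 : Vᴴ * V = 1 := by
      have := hVV 1
      rwa [Matrix.mul_one, submatrix_one _ hinj] at this
    intro x y hxy
    have := congrArg (Vᴴ *ᵥ ·) hxy
    simpa [mulVec_mulVec, h1] using this
  · rw [hVV, zero_smul]
    ext i j
    simp only [submatrix_apply, shiftMatrix, of_apply, he, Matrix.zero_apply]
    exact if_neg (by omega)

/-! ### Upper bound: Courant–Fischer -/

theorem le_cos_of_mem_rankNumericalRange_shiftMatrix {n k : ℕ} (hkn : k < n) {r : ℝ}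
    (h : (r : ℂ) ∈ rankNumericalRange (k + 1) (shiftMatrix n)) :
    r ≤ Real.cos (sineAngle n k) := by
  obtain ⟨P, hPP, hPH, hPr, hP⟩ := h
  set H : Matrix (Fin n) (Fin n) ℂ := shiftMatrix n + (shiftMatrix n)ᵀ with hH
  set w : Fin n → Fin n → ℂ := fun j => weightedSine n 1 (sineAngle n j) with hw
  set μ : Fin n → ℝ := fun j => Real.cos (sineAngle n j) with hμ
  have heig : ∀ j, H *ᵥ w j = ((2 * μ j : ℝ) : ℂ) • w j := by
    intro j
    -- At `u = 1` the weighted identity becomes the eigenvalue equation of `H`.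
    have := sq_smul_shiftMatrix_sub_mulVec_weightedSine (n := n) (r := μ j) (u := 1)
      (sin_succ_mul_sineAngle n j) (by simp only [hμ]; ring)
    simp only [Complex.ofReal_one, one_pow, one_smul, transpose_sub, transpose_smul,
      transpose_one, sub_mulVec, smul_mulVec, one_mulVec] at this
    rw [hH, add_mulVec]
    have h2 : ((2 * μ j : ℝ) : ℂ) • w j = (μ j : ℂ) • w j + (μ j : ℂ) • w j := by
      rw [← add_smul]; push_cast; ring_nf
    rw [h2]
    linear_combination (exp := 1) this
  have hHt : Hᵀ = H := by rw [hH, transpose_add, transpose_transpose, add_comm]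
  have horth : ∀ i j, i ≠ j → w i ⬝ᵥ w j = 0 := by
    intro i j hij
    have h1 : w i ⬝ᵥ H *ᵥ w j = w j ⬝ᵥ H *ᵥ w i := by
      rw [dotProduct_mulVec, dotProduct_comm, ← mulVec_transpose, hHt]
    rw [heig, heig, dotProduct_smul, dotProduct_smul, dotProduct_comm (w j), ← sub_eq_zero,
      ← sub_smul, smul_eq_mul] at h1
    refine (mul_eq_zero.1 h1).resolve_left ?_
    have : 2 * μ j - 2 * μ i ≠ 0 := by
      rcases lt_or_gt_of_ne hij with hlt | hlt
      · have : μ j < μ i := cos_sineAngle_lt hlt j.2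
        linarith
      · have : μ i < μ j := cos_sineAngle_lt hlt i.2
        linarith
    exact_mod_cast this
  set d : Fin n → ℝ := fun j => ∑ m, ‖w j m‖ ^ 2 with hd
  have hdw : ∀ j, w j ⬝ᵥ w j = (d j : ℂ) := by
    intro j
    have : star (w j) ⬝ᵥ w j = (d j : ℂ) := by
      simp only [dotProduct, hd, Pi.star_apply, Complex.ofReal_sum]
      refine Finset.sum_congr rfl fun m _ => ?_
      rw [Complex.ofReal_pow]
      exact Complex.conj_mul' _
    rwa [hw, star_weightedSine] at this
  have hdpos : ∀ j, 0 < d j := by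
    intro j
    obtain ⟨m, hm⟩ := Function.ne_iff.1 (weightedSine_ne_zero 1 j.2)
    have hm : w j m ≠ 0 := hm
    exact Finset.sum_pos' (fun i _ => by positivity) ⟨m, Finset.mem_univ _, by positivity⟩
  set Q : Matrix (Fin n) (Fin n) ℂ := (of w)ᵀ with hQ
  have hQQ : Qᴴ * Q = diagonal fun j => (d j : ℂ) := by
    ext i j
    have : (Qᴴ * Q) i j = star (w i) ⬝ᵥ w j := rfl
    rw [this, hw, star_weightedSine]
    change w i ⬝ᵥ w j = _
    rcases eq_or_ne i j with rfl | hij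
    · rw [hdw, diagonal_apply_eq]
    · rw [horth i j hij, diagonal_apply_ne _ hij]
  have hHQ : H * Q = Q * diagonal fun j => ((2 * μ j : ℝ) : ℂ) := by
    ext i j
    have h1 : (H * Q) i j = (H *ᵥ w j) i := rfl
    rw [h1, heig, mul_diagonal, Pi.smul_apply, smul_eq_mul, mul_comm]
    rfl
  have hQdet : IsUnit Q.det := by
    have h1 : (Qᴴ * Q).det ≠ 0 := by
      rw [hQQ, det_diagonal]
      exact Finset.prod_ne_zero_iff.2 fun j _ => by exact_mod_cast (hdpos j).ne'
    rw [det_mul] at h1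
    exact IsUnit.mk0 _ (right_ne_zero_of_mul h1)
  -- a nonzero vector in the range of `P` whose first `k` sine coefficients vanish
  obtain ⟨x, hPx, hx0, hxc⟩ : ∃ x : Fin n → ℂ, P *ᵥ x = x ∧ x ≠ 0 ∧
      ∀ j : Fin n, (j : ℕ) < k → (Q⁻¹ *ᵥ x) j = 0 := by
    let g : LinearMap.range P.mulVecLin →ₗ[ℂ] (Fin k → ℂ) :=
      (LinearMap.funLeft ℂ ℂ (Fin.castLE hkn.le)) ∘ₗ (Q⁻¹).mulVecLin ∘ₗ
        (LinearMap.range P.mulVecLin).subtype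
    have hg : LinearMap.ker g ≠ ⊥ := by
      apply LinearMap.ker_ne_bot_of_finrank_lt
      have : Module.finrank ℂ (LinearMap.range P.mulVecLin) = k + 1 := hPr
      rw [this, Module.finrank_fin_fun]
      exact Nat.lt_succ_self k
    obtain ⟨⟨x, y, hy⟩, hxg, hx0⟩ := Submodule.exists_mem_ne_zero_of_ne_bot hg
    refine ⟨x, ?_, fun h0 => hx0 (Subtype.ext h0), ?_⟩
    · rw [← hy, mulVecLin_apply, mulVec_mulVec, hPP]
    · intro j hj
      exact congrFun (LinearMap.mem_ker.1 hxg) ⟨j, hj⟩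
  set c := Q⁻¹ *ᵥ x with hc
  have hxQ : x = Q *ᵥ c := by rw [hc, mulVec_mulVec, mul_nonsing_inv _ hQdet, one_mulVec]
  have hPHP : P * H * P = ((2 * r : ℝ) : ℂ) • P := by
    -- Taking adjoints keeps the scalar because `r` is real.
    have h1 : P * (shiftMatrix n)ᵀ * P = (r : ℂ) • P := by
      have := congrArg conjTranspose hP
      simpa [conjTranspose_mul, hPH, shiftMatrix_conjTranspose, Matrix.mul_assoc] using this
    rw [hH, Matrix.mul_add, Matrix.add_mul, hP, h1, ← add_smul]
    push_cast
    ring_nf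
  have hsP : star x ᵥ* P = star x := by
    rw [← hPH, ← star_mulVec, hPx]
  have hE1 : star x ⬝ᵥ H *ᵥ x = ((2 * r : ℝ) : ℂ) * (star x ⬝ᵥ x) := by
    calc star x ⬝ᵥ H *ᵥ x = (star x ᵥ* P) ⬝ᵥ H *ᵥ (P *ᵥ x) := by rw [hsP, hPx]
      _ = star x ⬝ᵥ (P * H * P) *ᵥ x := by
        rw [← dotProduct_mulVec, mulVec_mulVec, mulVec_mulVec, Matrix.mul_assoc]
      _ = _ := by rw [hPHP, smul_mulVec, hPx, dotProduct_smul, smul_eq_mul]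
  have hxx : star x ⬝ᵥ x = ((∑ j, d j * ‖c j‖ ^ 2 : ℝ) : ℂ) := by
    have : star x ⬝ᵥ x = star c ⬝ᵥ (Qᴴ * Q) *ᵥ c := by
      rw [hxQ, star_mulVec, ← dotProduct_mulVec, mulVec_mulVec]
    rw [this, hQQ]
    simp only [dotProduct, mulVec_diagonal, Pi.star_apply, Complex.ofReal_sum]
    refine Finset.sum_congr rfl fun j _ => ?_
    have h1 : star (c j) * c j = (‖c j‖ : ℂ) ^ 2 := Complex.conj_mul' _
    push_cast
    linear_combination (d j : ℂ) * h1
  have hxHx : star x ⬝ᵥ H *ᵥ x = ((∑ j, 2 * μ j * (d j * ‖c j‖ ^ 2) : ℝ) : ℂ) := by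
    have : star x ⬝ᵥ H *ᵥ x = star c ⬝ᵥ (Qᴴ * (H * Q)) *ᵥ c := by
      rw [hxQ, star_mulVec, ← dotProduct_mulVec, mulVec_mulVec, mulVec_mulVec,
        Matrix.mul_assoc]
    rw [this, hHQ, ← Matrix.mul_assoc, hQQ, diagonal_mul_diagonal]
    simp only [dotProduct, mulVec_diagonal, Pi.star_apply, Complex.ofReal_sum]
    refine Finset.sum_congr rfl fun j _ => ?_
    have h1 : star (c j) * c j = (‖c j‖ : ℂ) ^ 2 := Complex.conj_mul' _
    push_cast
    linear_combination (2 * μ j * d j : ℂ) * h1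
  have hreal : ∑ j, 2 * μ j * (d j * ‖c j‖ ^ 2) = 2 * r * ∑ j, d j * ‖c j‖ ^ 2 := by
    rw [hxx, hxHx] at hE1
    exact_mod_cast hE1
  have hle : ∑ j, 2 * μ j * (d j * ‖c j‖ ^ 2) ≤
      2 * Real.cos (sineAngle n k) * ∑ j, d j * ‖c j‖ ^ 2 := by
    rw [Finset.mul_sum]
    refine Finset.sum_le_sum fun j _ => ?_
    -- The coefficients below `k` vanish; beyond `k` the cosines are smaller.
    rcases lt_trichotomy (j : ℕ) k with hj | hj | hj
    · simp [hxc j hj]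
    · simp [hμ, hj]
    · have : μ j < Real.cos (sineAngle n k) := cos_sineAngle_lt hj j.2
      have := (hdpos j).le
      gcongr
  have hpos : 0 < ∑ j, d j * ‖c j‖ ^ 2 := by
    have hc0 : c ≠ 0 := by
      intro h0
      exact hx0 (by rw [hxQ, h0, mulVec_zero])
    obtain ⟨m, hm⟩ := Function.ne_iff.1 hc0
    have hm : 0 < ‖c m‖ := norm_pos_iff.2 hm
    exact Finset.sum_pos' (fun i _ => mul_nonneg (hdpos i).le (by positivity))
      ⟨m, Finset.mem_univ _, mul_pos (hdpos m) (by positivity)⟩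
  rw [hreal] at hle
  have := le_of_mul_le_mul_right hle hpos
  linarith

theorem theorem2p1 (n k : ℕ) (hn : 2 ≤ n) (hk : 1 ≤ k) (hkn : k ≤ n) :
    (k ≤ (n + 1) / 2 →
      rankNumericalRange k (shiftMatrix n) =
        {z : ℂ | ‖z‖ ≤ Real.cos ((k : ℝ) * Real.pi / ((n : ℝ) + 1))}) ∧
    ((n + 1) / 2 < k →
      rankNumericalRange k (shiftMatrix n) = ∅) := by
  obtain ⟨k, rfl⟩ : ∃ l, k = l + 1 := ⟨k - 1, by omega⟩
  change (_ → _ = {z : ℂ | ‖z‖ ≤ Real.cos (sineAngle n k)}) ∧ _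
  have hub : ∀ z ∈ rankNumericalRange (k + 1) (shiftMatrix n),
      ‖z‖ ≤ Real.cos (sineAngle n k) := fun z hz =>
    le_cos_of_mem_rankNumericalRange_shiftMatrix hkn
      (mem_rankNumericalRange_shiftMatrix_iff_norm.1 hz)
  constructor
  · intro hk2
    refine Set.Subset.antisymm hub fun z hz => ?_
    rw [mem_rankNumericalRange_shiftMatrix_iff_norm]
    rcases eq_or_ne z 0 with rfl | hz0
    · simpa using zero_mem_rankNumericalRange_shiftMatrix hk2
    · exact mem_rankNumericalRange_shiftMatrix_of_pos hkn (norm_pos_iff.2 hz0) hz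
  · intro hk2
    refine Set.eq_empty_iff_forall_notMem.2 fun z hz => ?_
    -- The rank `k + 1` exceeds `(n + 1) / 2`, which puts the angle strictly between `π / 2` and
    -- `π`.
    have hneg : Real.cos (sineAngle n k) < 0 := by
      refine Real.cos_neg_of_pi_div_two_lt_of_lt ?_
        ((sineAngle_lt_pi hkn).trans (by linarith [Real.pi_pos]))
      have h1 : ((n : ℝ) + 1) < 2 * ((k + 1 : ℕ) : ℝ) := by
        have : n + 1 < 2 * (k + 1) := by omega
        exact_mod_cast this
      rw [sineAngle, div_lt_div_iff₀ (by norm_num) (by positivity)]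
      nlinarith [Real.pi_pos]
    linarith [hub z hz, norm_nonneg z]
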